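/- Let $\mathcal M$ be an oriented matroid on a finite set $E$, given by its set of covectors $\mathcal C\subseteq\{0,+1,-1\}^E$, and let $M=\underline{\mathcal M}$ be its underlying matroid, whose flats are the sets $E\setminus\mathrm{Supp}(X)$, $X\in\mathcal C$. For $i\in E$, the covectors of $\mathcal M\backslash i$ are the restrictions of covectors of $\mathcal M$ to $E\setminus i$, and those of $\mathcal M/i$ are the restrictions to $E\setminus i$ of the covectors $X$ with $X_i=0$. *Fans.* If $M$ is loopfree, $\Sigma_M\subseteq\mathbb R^E$ is the fan consisting of the cones $\sigma_{\mathcal F}=\langle v_{F_1},\dots,v_{F_k},v_E,-v_E\rangle_{\ge 0}$, where $v_I=-\sum_{j\in I}e_j$, for all chains of flats $\mathcal F=\{\emptyset\subsetneq F_1\subsetneq\dots\subsetneq F_k\subsetneq E\}$. Its facets (maximal cones) correspond to the maximal chains. If $M$ has loops $L=\mathrm{cl}(\emptyset)$, put $\Sigma_M:=\Sigma_{M/L}\subseteq\mathbb R^{E\setminus L}$. *The map $\mathcal E_{\mathcal M}$.* If $\mathcal M$ is loopfree and $\sigma_{\mathcal F}$ is a facet of $\Sigma_M$, let $\mathcal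 E_{\mathcal M}(\sigma_{\mathcal F})$ be the set of all $\varepsilon\in\mathbb Z_2^E$ such that $T=(-1)^\varepsilon$ is a tope (maximal covector) of $\mathcal M$ and, for every $F\in\mathcal F$, the vector $T\setminus F$ obtained from $T$ by setting the coordinates in $F$ to $0$ is a covector. In general put $\mathcal E_{\mathcal M}:=\mathcal E_{\mathcal M\backslash L}$, with values in the subsets of $\mathbb Z_2^{E\setminus L}$. *Deletion and contraction.* Let $\mathcal E$ be a map from the facets of $\Sigma_M$ to the subsets of $\mathbb Z_2^{E\setminus L}$, let $i\in E$, let $p_A$ be the projection forgetting the coordinates in $A$, and describe chains of flats up to removing loops. - For a facet $\sigma$ of $\Sigma_{M\backslash i}$ set $(\mathcal E\backslash i)(\sigma)=p_i(\mathcal E(p_i^*(\sigma)))$. Here, if $i$ is not a coloop of $M$, $p_i^*(\sigma)$ is the facet of $\Sigma_M$ whose chain consists of the closures in $M$ of the flats in the chain of $\sigma$. If $i$ is a coloop and $\sigma$ has chain $\emptyset\subsetneq F_1\subsetneq\dots\subsetneq F_k\subsetneq E\setminus i$, then $p_i^*(\sigma)$ has chain $\emptyset\subsetneq\{i\}\subsetneq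 F_1\cup i\subsetneq\dots\subsetneq F_k\cup i\subsetneq E$. - For a facet $\sigma$ of $\Sigma_{M/i}$ with chain $\emptyset\subsetneq F_1\subsetneq\dots\subsetneq F_k\subsetneq E\setminus\mathrm{cl}(i)$ set $(\mathcal E/i)(\sigma)=p_{\mathrm{cl}(i)}(\mathcal E(p^\diamond_{\mathrm{cl}(i)}(\sigma)))$, where $p^\diamond_{\mathrm{cl}(i)}(\sigma)$ is the facet of $\Sigma_M$ with chain $\mathrm{cl}(\emptyset)\subseteq\mathrm{cl}(i)\subsetneq F_1\sqcup\mathrm{cl}(i)\subsetneq\dots\subsetneq F_k\sqcup\mathrm{cl}(i)\subsetneq E$. **Proposition.** For every oriented matroid $\mathcal M$ on $E$ with underlying matroid $M$ and every $i\in E$, one has $\underline{\mathcal M/i}=M/i$ and $\underline{\mathcal M\backslash i}=M\backslash i$, and $$\mathcal E_{\mathcal M/i}=\mathcal E_{\mathcal M}/i\quad\text{and}\quad \mathcal E_{\mathcal M\backslash i}=\mathcal E_{\mathcal M}\backslash i$$ as maps on the facets of $\Sigma_{M/i}$ and of $\Sigma_{M\backslash i}$, respectively. -/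

import Mathlib

/-! ### Oriented matroids in terms of covectors -/

/-- The composition `X ∘ Y` of sign vectors. -/
def signComp {α : Type*} (X Y : α → SignType) : α → SignType :=
  fun e => if X e = 0 then Y e else X e

/-- The separation set `S(X, Y)` of two sign vectors. -/
def signSep {α : Type*} (X Y : α → SignType) : Set α :=
  {e | X e = -Y e ∧ X e ≠ 0}

/-- The partial order on sign vectors induced coordinatewise by `0 < +1`, `0 < -1`. -/
def signLE {α : Type*} (X Y : α → SignType) : Prop :=
  ∀ e, X e ≠ 0 → X e = Y e

open Classical in
/-- The vector `X \ A`: all coordinates in `A` are set to zero. -/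
noncomputable def signErase {α : Type*} (X : α → SignType) (A : Set α) : α → SignType :=
  fun e => if e ∈ A then 0 else X e

/-- An oriented matroid on a finite ground set `E ⊆ α`, given by its covectors. A sign vector in
`{0, +1, -1}^E` is represented by its extension by zero to `α`. -/
@[ext]
structure OrientedMatroid (α : Type*) where
  /-- the ground set -/
  E : Set α
  finite_ground : E.Finite
  /-- the set of covectors -/
  covectors : Set (α → SignType)
  supp_subset : ∀ X ∈ covectors, ∀ e, X e ≠ 0 → e ∈ E
  zero_mem : (0 : α → SignType) ∈ covectors
  neg_mem : ∀ X ∈ covectors, -X ∈ covectors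
  comp_mem : ∀ X ∈ covectors, ∀ Y ∈ covectors, signComp X Y ∈ covectors
  elim : ∀ X ∈ covectors, ∀ Y ∈ covectors, ∀ i ∈ signSep X Y, ∃ Z ∈ covectors,
    Z i = 0 ∧ ∀ j, j ∉ signSep X Y → Z j = signComp X Y j

namespace OrientedMatroid

/-- The deletion `𝓜 \ A`: the covectors are the restrictions to `E \ A` of the covectors. -/
def delete {α : Type*} (𝓜 : OrientedMatroid α) (A : Set α) : OrientedMatroid α where
  E := 𝓜.E \ A
  finite_ground := 𝓜.finite_ground.subset Set.sdiff_subset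
  covectors := (fun X => signErase X A) '' 𝓜.covectors
  supp_subset := by
    rintro _ ⟨X, hX, rfl⟩ e he
    by_cases h : e ∈ A
    · simp [signErase, h] at he
    · exact ⟨𝓜.supp_subset X hX e (by simpa [signErase, h] using he), h⟩
  zero_mem := ⟨0, 𝓜.zero_mem, by ext e; simp [signErase]⟩
  neg_mem := by
    rintro _ ⟨X, hX, rfl⟩
    refine ⟨-X, 𝓜.neg_mem X hX, ?_⟩
    funext e
    by_cases h : e ∈ A <;> simp [signErase, h]
  comp_mem := by
    rintro _ ⟨X, hX, rfl⟩ _ ⟨Y, hY, rfl⟩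
    refine ⟨signComp X Y, 𝓜.comp_mem X hX Y hY, ?_⟩
    funext e
    by_cases h : e ∈ A <;> simp [signErase, signComp, h]
  elim := by
    rintro _ ⟨X, hX, rfl⟩ _ ⟨Y, hY, rfl⟩ i hi
    have hiA : i ∉ A := by
      intro h
      simp [signSep, signErase, h] at hi
    obtain ⟨Z, hZ, hZi, hZj⟩ := 𝓜.elim X hX Y hY i (by simpa [signSep, signErase, hiA] using hi)
    refine ⟨_, ⟨Z, hZ, rfl⟩, by simp [signErase, hiA, hZi], fun j hj => ?_⟩
    by_cases h : j ∈ A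
    · simp [signErase, signComp, h]
    · have := hZj j (by simpa [signSep, signErase, h] using hj)
      simpa [signErase, signComp, h] using this

/-- The contraction `𝓜 / A`: the covectors are the restrictions to `E \ A` of the covectors that
vanish on `A`. Such a covector is already supported in `E \ A`. -/
def contract {α : Type*} (𝓜 : OrientedMatroid α) (A : Set α) : OrientedMatroid α where
  E := 𝓜.E \ A
  finite_ground := 𝓜.finite_ground.subset Set.sdiff_subset
  covectors := {X | X ∈ 𝓜.covectors ∧ ∀ e ∈ A, X e = 0}
  supp_subset := fun X hX e he => ⟨𝓜.supp_subset X hX.1 e he, fun h => he (hX.2 e h)⟩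
  zero_mem := ⟨𝓜.zero_mem, fun _ _ => rfl⟩
  neg_mem := fun X hX => ⟨𝓜.neg_mem X hX.1, fun e he => by simp [hX.2 e he]⟩
  comp_mem := fun X hX Y hY =>
    ⟨𝓜.comp_mem X hX.1 Y hY.1, fun e he => by simp [signComp, hX.2 e he, hY.2 e he]⟩
  elim := by
    intro X hX Y hY i hi
    obtain ⟨Z, hZ, hZi, hZj⟩ := 𝓜.elim X hX.1 Y hY.1 i hi
    refine ⟨Z, ⟨hZ, fun e he => ?_⟩, hZi, hZj⟩
    rw [hZj e (by simp [signSep, hX.2 e he])]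
    simp [signComp, hX.2 e he, hY.2 e he]

/-- `e` lies in the closure of `A`: every covector vanishing on `A` vanishes at `e`. -/
def InClosure {α : Type*} (𝓜 : OrientedMatroid α) (A : Set α) (e : α) : Prop :=
  ∀ X ∈ 𝓜.covectors, (∀ f ∈ A, X f = 0) → X e = 0

theorem inClosure_exchange {α : Type*} (𝓜 : OrientedMatroid α) {A : Set α} {e f : α}
    (h : 𝓜.InClosure (insert f A) e) (he : ¬ 𝓜.InClosure A e) :
    𝓜.InClosure (insert e A) f := by
  intro X hX hX0
  by_contra hXf
  simp only [InClosure, not_forall] at he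
  obtain ⟨Y, hY, hY0, hYe⟩ := he
  have key : ∀ W ∈ 𝓜.covectors, (∀ a ∈ A, W a = 0) → W e ≠ 0 → W f = -X f → False := by
    intro W hW hW0 hWe hWf
    obtain ⟨Z, hZ, hZf, hZj⟩ := 𝓜.elim X hX W hW f ⟨by rw [hWf, neg_neg], hXf⟩
    have hXe : X e = 0 := hX0 e (Set.mem_insert _ _)
    have hZe : Z e = W e := by
      rw [hZj e (by simp [signSep, hXe])]
      simp [signComp, hXe]
    refine hWe (hZe ▸ h Z hZ ?_)
    rintro a (rfl | ha)
    · exact hZf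
    · have hXa : X a = 0 := hX0 a (Set.mem_insert_of_mem _ ha)
      rw [hZj a (by simp [signSep, hXa])]
      simp [signComp, hXa, hW0 a ha]
  have hYf : Y f ≠ 0 := fun hYf => hYe (h Y hY (by
    rintro a (rfl | ha)
    · exact hYf
    · exact hY0 a ha))
  have hcases : ∀ s t : SignType, s ≠ 0 → t ≠ 0 → t = -s ∨ -t = -s := by decide
  rcases hcases (X f) (Y f) hXf hYf with h1 | h1
  · exact key Y hY hY0 hYe h1
  · refine key (-Y) (𝓜.neg_mem Y hY) (fun a ha => by simp [hY0 a ha]) ?_ (by simpa using h1)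
    intro h0
    exact hYe (by simpa using h0)

/-- Independence in the underlying matroid: no element of `I` is in the closure of the others. -/
def Indep {α : Type*} (𝓜 : OrientedMatroid α) (I : Set α) : Prop :=
  I ⊆ 𝓜.E ∧ ∀ e ∈ I, ¬ 𝓜.InClosure (I \ {e}) e

theorem Indep.subset {α : Type*} {𝓜 : OrientedMatroid α} {I J : Set α}
    (hJ : 𝓜.Indep J) (hIJ : I ⊆ J) : 𝓜.Indep I := by
  refine ⟨hIJ.trans hJ.1, fun e he hcl => hJ.2 e (hIJ he) fun X hX h0 => hcl X hX fun f hf => ?_⟩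
  exact h0 f ⟨hIJ hf.1, hf.2⟩

theorem Indep.insert_of_not_inClosure {α : Type*} {𝓜 : OrientedMatroid α} {I : Set α} {x : α}
    (hI : 𝓜.Indep I) (hx : x ∈ 𝓜.E) (hcl : ¬ 𝓜.InClosure I x) : 𝓜.Indep (insert x I) := by
  have hxI : x ∉ I := fun h => hcl fun X _ h0 => h0 x h
  refine ⟨Set.insert_subset hx hI.1, ?_⟩
  rintro e (rfl | he)
  · simpa [hxI] using hcl
  · intro h
    have hex : e ≠ x := fun h' => hxI (h' ▸ he)
    have hset : insert x I \ {e} = insert x (I \ {e}) := by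
      ext a
      simp only [Set.mem_sdiff, Set.mem_insert_iff, Set.mem_singleton_iff]
      grind
    rw [hset] at h
    have h2 := 𝓜.inClosure_exchange h (hI.2 e he)
    rw [Set.insert_sdiff_singleton, Set.insert_eq_of_mem he] at h2
    exact hcl h2

/-- The underlying matroid of an oriented matroid. -/
def underlying {α : Type*} (𝓜 : OrientedMatroid α) : Matroid α :=
  (IndepMatroid.ofBdd 𝓜.E 𝓜.Indep ⟨Set.empty_subset _, by simp⟩
    (fun _ _ hJ hIJ => hJ.subset hIJ)
    (by
      intro I B hI hImax hB
      by_contra! hcon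
      obtain ⟨e, heI, hins⟩ := Set.exists_insert_of_not_maximal (fun _ _ h h' => h.subset h') hI hImax
      have heE : e ∈ 𝓜.E := hins.1 (Set.mem_insert _ _)
      have hBcl : ∀ x ∈ B, 𝓜.InClosure I x := by
        intro x hx
        by_cases hxI : x ∈ I
        · exact fun X _ h0 => h0 x hxI
        · by_contra hcl
          exact hcon x ⟨hx, hxI⟩ (hI.insert_of_not_inClosure (hB.prop.1 hx) hcl)
      have heB : 𝓜.InClosure B e := by
        by_contra hcl
        have heB : e ∈ B :=
          hB.2 (hB.prop.insert_of_not_inClosure heE hcl) (Set.subset_insert _ _)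
            (Set.mem_insert _ _)
        exact hcl fun X _ h0 => h0 e heB
      refine hins.2 e (Set.mem_insert _ _) ?_
      rw [Set.insert_sdiff_of_mem _ (Set.mem_singleton _), Set.sdiff_singleton_eq_self heI]
      exact fun X hX h0 => heB X hX fun x hx => hBcl x hx X hX h0)
    (fun _ h => h.1)
    ⟨𝓜.E.ncard, fun I hI => by
      rw [𝓜.finite_ground.cast_ncard_eq]
      exact Set.encard_le_encard hI.1⟩).matroid

@[simp]
theorem underlying_E {α : Type*} (𝓜 : OrientedMatroid α) : 𝓜.underlying.E = 𝓜.E := rfl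

theorem underlying_indep {α : Type*} (𝓜 : OrientedMatroid α) {I : Set α} :
    𝓜.underlying.Indep I ↔ 𝓜.Indep I := Iff.rfl

theorem mem_underlying_closure {α : Type*} (𝓜 : OrientedMatroid α) {A : Set α} (hA : A ⊆ 𝓜.E)
    {e : α} : e ∈ 𝓜.underlying.closure A ↔ e ∈ 𝓜.E ∧ 𝓜.InClosure A e := by
  obtain ⟨I, hI⟩ := 𝓜.underlying.exists_isBasis A hA
  have hIi : 𝓜.Indep I := hI.indep
  have hcl : ∀ x ∈ A, 𝓜.InClosure I x := by
    intro x hx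
    by_contra h
    have hi := hIi.insert_of_not_inClosure (hA hx) h
    have : x ∈ I := hI.mem_of_insert_indep hx hi
    exact h fun X _ h0 => h0 x this
  rw [← hI.closure_eq_closure, hI.indep.mem_closure_iff']
  constructor
  · rintro ⟨he, h⟩
    refine ⟨he, ?_⟩
    by_contra hne
    have h1 : ¬ 𝓜.InClosure I e := fun h' => hne fun X hX h0 =>
      h' X hX fun f hf => h0 f (hI.subset hf)
    have := h (hIi.insert_of_not_inClosure he h1)
    exact h1 fun X _ h0 => h0 e this
  · rintro ⟨he, h⟩
    refine ⟨he, fun hins => ?_⟩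
    by_contra heI
    refine (show 𝓜.Indep (insert e I) from hins).2 e (Set.mem_insert _ _) ?_
    rw [Set.insert_sdiff_of_mem _ (Set.mem_singleton _), Set.sdiff_singleton_eq_self heI]
    exact fun X hX h0 => h X hX fun x hx => hcl x hx X hX h0

/-- The flats of the underlying matroid are exactly the complements `Supp(X)ᶜ` of the supports of
the covectors `X`. -/
theorem underlying_isFlat_iff {α : Type*} (𝓜 : OrientedMatroid α) {F : Set α} :
    𝓜.underlying.IsFlat F ↔ ∃ X ∈ 𝓜.covectors, F = {e | e ∈ 𝓜.E ∧ X e = 0} := by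
  constructor
  · intro hF
    have hFE : F ⊆ 𝓜.E := hF.subset_ground
    have hsep : ∀ e ∈ 𝓜.E \ F, ∃ X ∈ 𝓜.covectors, (∀ f ∈ F, X f = 0) ∧ X e ≠ 0 := by
      intro e he
      have h1 : ¬ 𝓜.InClosure F e := fun h => he.2 (by
        rw [← hF.closure]
        exact (𝓜.mem_underlying_closure hFE).2 ⟨he.1, h⟩)
      simpa [InClosure] using h1
    have hind : ∀ s : Finset α, (s : Set α) ⊆ 𝓜.E \ F →
        ∃ X ∈ 𝓜.covectors, (∀ f ∈ F, X f = 0) ∧ ∀ e ∈ s, X e ≠ 0 := by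
      classical
      intro s
      induction s using Finset.induction_on with
      | empty => exact fun _ => ⟨0, 𝓜.zero_mem, fun _ _ => rfl, by simp⟩
      | insert a s _ ih =>
        intro hs
        obtain ⟨X, hX, hX0, hXs⟩ := ih (fun x hx => hs (by simp [Finset.mem_coe.1 hx]))
        obtain ⟨Y, hY, hY0, hYa⟩ := hsep a (hs (by simp))
        refine ⟨signComp X Y, 𝓜.comp_mem X hX Y hY,
          fun f hf => by simp [signComp, hX0 f hf, hY0 f hf], ?_⟩
        intro e he
        rcases Finset.mem_insert.1 he with rfl | he
        · by_cases h : X e = 0 <;> simp [signComp, h, hYa]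
        · simp [signComp, hXs e he]
    obtain ⟨X, hX, hX0, hXs⟩ := hind (𝓜.finite_ground.subset
      (Set.sdiff_subset : 𝓜.E \ F ⊆ 𝓜.E)).toFinset (by simp)
    refine ⟨X, hX, ?_⟩
    ext e
    constructor
    · exact fun he => ⟨hFE he, hX0 e he⟩
    · rintro ⟨he, h0⟩
      by_contra heF
      exact hXs e (by simpa using ⟨he, heF⟩) h0
  · rintro ⟨X, hX, rfl⟩
    have hsub : {e | e ∈ 𝓜.E ∧ X e = 0} ⊆ 𝓜.E := fun e he => he.1
    rw [Matroid.isFlat_iff_closure_eq]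
    refine Set.Subset.antisymm ?_ (𝓜.underlying.subset_closure _ hsub)
    intro e he
    rw [𝓜.mem_underlying_closure hsub] at he
    exact ⟨he.1, he.2 X hX fun f hf => hf.2⟩

/-- The topes: the maximal covectors. -/
def IsTope {α : Type*} (𝓜 : OrientedMatroid α) (T : α → SignType) : Prop :=
  T ∈ 𝓜.covectors ∧ ∀ X ∈ 𝓜.covectors, signLE T X → X = T

/-- The set `𝓣(𝓕)` of topes adjacent to a flag of flats. -/
def adjacentTopes {α : Type*} (𝓜 : OrientedMatroid α) (𝓕 : Set (Set α)) : Set (α → SignType) :=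
  {T | 𝓜.IsTope T ∧ ∀ F ∈ 𝓕, signErase T F ∈ 𝓜.covectors}

end OrientedMatroid

/-! ### Matroid fans

The space `ℝ^S`, for `S ⊆ α`, is represented by the functions `α → ℝ` that vanish outside `S`, and
likewise for `ℤ₂^S`. -/

open Classical in
/-- The vector `v_I = ∑_{i ∈ I} v_i`, where `v_i = -e_i`. -/
noncomputable def flatVector {α : Type*} (I : Set α) : α → ℝ :=
  fun e => if e ∈ I then -1 else 0

/-- The cone `σ_𝓕 = ⟨v_F (F ∈ 𝓕), v_E, -v_E⟩_{≥ 0}`. -/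
noncomputable def flagCone {α : Type*} (E : Set α) (𝓕 : Set (Set α)) : PointedCone ℝ (α → ℝ) :=
  PointedCone.hull ℝ (flatVector '' 𝓕 ∪ {flatVector E, -flatVector E})

namespace Matroid

/-- A chain `F₁ ⊊ ⋯ ⊊ F_k` of flats with `∅ ⊊ F₁` and `F_k ⊊ E`. -/
def IsFlag {α : Type*} (M : Matroid α) (𝓕 : Set (Set α)) : Prop :=
  (∀ F ∈ 𝓕, M.IsFlat F ∧ F.Nonempty ∧ F ≠ M.E) ∧ IsChain (· ⊆ ·) 𝓕

/-- The matroid `M / L` on `E \ L`, where `L = cl(∅)` is the set of loops of `M`. It is `M` itself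
if `M` is loopfree. -/
def loopfree {α : Type*} (M : Matroid α) : Matroid α := M.contract M.loops

/-- The affine matroid fan `Σ_M = Σ_{M / L} ⊆ ℝ^{E \ L}`, as the collection of its cones. -/
def fan {α : Type*} (M : Matroid α) : Set (PointedCone ℝ (α → ℝ)) :=
  {σ | ∃ 𝓕, M.loopfree.IsFlag 𝓕 ∧ σ = flagCone M.loopfree.E 𝓕}

/-- The facets of `Σ_M`: the cones that are maximal with respect to inclusion. -/
def facets {α : Type*} (M : Matroid α) : Set (PointedCone ℝ (α → ℝ)) :=
  {σ | Maximal (· ∈ M.fan) σ}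

/-- The chain of flats `𝓕` that describes a cone `σ = σ_𝓕` of `Σ_M`
(see `Matroid.flagOf_flagCone`). -/
def flagOf {α : Type*} (M : Matroid α) (σ : PointedCone ℝ (α → ℝ)) : Set (Set α) :=
  {F | (M.loopfree.IsFlat F ∧ F.Nonempty ∧ F ≠ M.loopfree.E) ∧ flatVector F ∈ σ}

end Matroid

theorem le_of_mem_flagCone {α : Type*} {E : Set α} {𝓕 : Set (Set α)} {x : α → ℝ}
    (hx : x ∈ flagCone E 𝓕) {a b : α} (ha : a ∈ E) (hb : b ∈ E)
    (hab : ∀ F ∈ 𝓕, a ∈ F → b ∈ F) : x b ≤ x a := by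
  induction hx using Submodule.span_induction with
  | mem x hx =>
    rcases hx with ⟨F, hF, rfl⟩ | rfl | rfl
    · have := hab F hF
      by_cases h1 : a ∈ F
      · simp [flatVector, h1, this h1]
      · by_cases h2 : b ∈ F <;> simp [flatVector, h1, h2]
    · simp [flatVector, ha, hb]
    · simp [flatVector, ha, hb]
  | zero => simp
  | add x y _ _ h1 h2 => exact add_le_add h1 h2
  | smul c x _ h => exact mul_le_mul_of_nonneg_left h c.2

/-- A chain of flats is recovered from its cone. -/
theorem Matroid.flagOf_flagCone {α : Type*} (M : Matroid α) (hM : M.E.Finite) {𝓕 : Set (Set α)}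
    (h𝓕 : M.loopfree.IsFlag 𝓕) : M.flagOf (flagCone M.loopfree.E 𝓕) = 𝓕 := by
  have hE : M.loopfree.E.Finite := hM.subset Set.sdiff_subset
  ext S
  constructor
  · rintro ⟨⟨hS, hne, hSE⟩, hmem⟩
    have hSsub := hS.subset_ground
    have hup : ∀ a ∈ S, ∀ b ∈ M.loopfree.E, (∀ F ∈ 𝓕, a ∈ F → b ∈ F) → b ∈ S := by
      intro a ha b hb hab
      have := le_of_mem_flagCone hmem (hSsub ha) hb hab
      by_contra hbS
      simp only [flatVector, ha, hbS, if_true, if_false] at this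
      norm_num at this
    have hsub𝓕 : ∀ F ∈ 𝓕, F ⊆ M.loopfree.E := fun F hF => (h𝓕.1 F hF).1.subset_ground
    have hfin : 𝓕.Finite := hE.finite_subsets.subset hsub𝓕
    obtain ⟨b, hbE, hbS⟩ : ∃ b ∈ M.loopfree.E, b ∉ S := by
      by_contra! h
      exact hSE (hSsub.antisymm h)
    have hloc : ∀ a ∈ S, ∃ F ∈ 𝓕, a ∈ F ∧ F ⊆ S := by
      intro a ha
      have hnon : {F ∈ 𝓕 | a ∈ F}.Nonempty := by
        by_contra h
        rw [Set.not_nonempty_iff_eq_empty] at h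
        refine hbS (hup a ha b hbE fun F hF haF => ?_)
        exact absurd (show F ∈ {F ∈ 𝓕 | a ∈ F} from ⟨hF, haF⟩) (by simp [h])
      obtain ⟨F, hF⟩ := (hfin.subset (Set.sep_subset 𝓕 _)).exists_minimal hnon
      refine ⟨F, hF.prop.1, hF.prop.2, fun c hc => ?_⟩
      refine hup a ha c (hsub𝓕 F hF.prop.1 hc) fun G hG haG => ?_
      rcases h𝓕.2.total hF.prop.1 hG with h | h
      · exact h hc
      · exact hF.2 ⟨hG, haG⟩ h hc
    obtain ⟨a₀, ha₀⟩ := hne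
    obtain ⟨F₀, hF₀, -, hF₀S⟩ := hloc a₀ ha₀
    obtain ⟨F, hF⟩ := (hfin.subset (Set.sep_subset 𝓕 (· ⊆ S))).exists_maximal ⟨F₀, hF₀, hF₀S⟩
    have hFS : F = S := by
      refine hF.prop.2.antisymm fun a ha => ?_
      obtain ⟨G, hG, haG, hGS⟩ := hloc a ha
      rcases h𝓕.2.total hF.prop.1 hG with h | h
      · exact hF.2 ⟨hG, hGS⟩ h haG
      · exact h haG
    exact hFS ▸ hF.prop.1
  · intro hS
    exact ⟨h𝓕.1 S hS, Submodule.subset_span (Or.inl ⟨S, hS, rfl⟩)⟩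

/-! ### Assignments of subsets of `ℤ₂^{E \ L}` to the facets, deletion and contraction

An assignment of subsets of `ℤ₂^{E \ L}` to the facets of `Σ_M` is a function
`PointedCone ℝ (α → ℝ) → Set (α → ZMod 2)`, of which only the values on `M.facets` matter. -/

open Classical in
/-- The coordinate projection `p_A : ℤ₂^S → ℤ₂^{S \ A}`. -/
noncomputable def coordProj {α : Type*} (A : Set α) (ε : α → ZMod 2) : α → ZMod 2 :=
  fun e => if e ∈ A then 0 else ε e

namespace Matroid

open Classical in
/-- The facet `p_i^*(σ)` of `Σ_M` for a facet `σ` of `Σ_{M \ i}`: take the closures in `M` of the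
flats describing `σ` if `i` is not a coloop; otherwise add `i` to all members of the chain,
the empty set at its beginning included. -/
noncomputable def pStar {α : Type*} (M : Matroid α) (i : α) (σ : PointedCone ℝ (α → ℝ)) :
    PointedCone ℝ (α → ℝ) :=
  if M.IsColoop i then
    flagCone M.loopfree.E (insert {i} ((fun F => insert i F) '' (M.delete {i}).flagOf σ))
  else
    flagCone M.loopfree.E (M.loopfree.closure '' (M.delete {i}).flagOf σ)

/-- The facet `p_{cl(i)}^⋄(σ)` of `Σ_M` for a facet `σ` of `Σ_{M / i}`: the members of its chain are
`cl(i)` and `F ⊔ cl(i)` for the members `F` of the chain of `σ` (loops of `M` being removed). -/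
noncomputable def pDiamond {α : Type*} (M : Matroid α) (i : α) (σ : PointedCone ℝ (α → ℝ)) :
    PointedCone ℝ (α → ℝ) :=
  flagCone M.loopfree.E (insert (M.closure {i} \ M.loops)
    ((fun F => F ∪ (M.closure {i} \ M.loops)) '' (M.contract {i}).flagOf σ))

/-- The deletion `(𝓔 \ i)(σ) = p_i(𝓔(p_i^*(σ)))`. -/
noncomputable def phaseDelete {α : Type*} (M : Matroid α)
    (𝓔 : PointedCone ℝ (α → ℝ) → Set (α → ZMod 2)) (i : α) :
    PointedCone ℝ (α → ℝ) → Set (α → ZMod 2) :=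
  fun σ => coordProj {i} '' 𝓔 (M.pStar i σ)

/-- The contraction `(𝓔 / i)(σ) = p_{cl(i)}(𝓔(p_{cl(i)}^⋄(σ)))`. -/
noncomputable def phaseContract {α : Type*} (M : Matroid α)
    (𝓔 : PointedCone ℝ (α → ℝ) → Set (α → ZMod 2)) (i : α) :
    PointedCone ℝ (α → ℝ) → Set (α → ZMod 2) :=
  fun σ => coordProj (M.closure {i}) '' 𝓔 (M.pDiamond i σ)

end Matroid

/-! ### The assignment given by an oriented matroid -/

open Classical in
/-- The sign vector `(-1)^ε ∈ {+1, -1}^E` of `ε ∈ ℤ₂^E`, extended by zero to `α`. -/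
noncomputable def signPow {α : Type*} (E : Set α) (ε : α → ZMod 2) : α → SignType :=
  fun e => if e ∈ E then (if ε e = 0 then 1 else -1) else 0

namespace OrientedMatroid

/-- For loopfree `𝓜`: the set of all `ε ∈ ℤ₂^E` such that `(-1)^ε` is a tope adjacent to the flag
of flats that describes `σ`. -/
def phaseOfLoopfree {α : Type*} (𝓜 : OrientedMatroid α) (σ : PointedCone ℝ (α → ℝ)) :
    Set (α → ZMod 2) :=
  {ε | (∀ e, e ∉ 𝓜.E → ε e = 0) ∧
    signPow 𝓜.E ε ∈ 𝓜.adjacentTopes (𝓜.underlying.flagOf σ)}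

/-- The assignment `𝓔_𝓜`, defined through the loopfree oriented matroid `𝓜 \ L`, where `L` is the
set of loops (so through `𝓜` itself if `𝓜` is loopfree). -/
def phase {α : Type*} (𝓜 : OrientedMatroid α) :
    PointedCone ℝ (α → ℝ) → Set (α → ZMod 2) :=
  (𝓜.delete 𝓜.underlying.loops).phaseOfLoopfree

end OrientedMatroid

/-! ### Closure and flats of minors, loops, topes -/

namespace OrientedMatroid

variable {α : Type*}

/-! Closure is read off from covectors: `e` lies in the closure of `A` when every covector vanishing
on `A` vanishes at `e`. For both minors this condition translates into the one for `𝓜`, and a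
matroid is determined by its closure operator (`underlying_contract`, `underlying_delete`).

For the maps on facets, `ε ↦ (-1)^ε` turns coordinate projection into setting coordinates to zero. A
chain is recovered from its cone up to the members `∅` and `E`, and these two impose no condition on
a tope. So `phase_eq_coordProj_image` leaves only one question: which topes `T'` of `𝓜` restrict to
a given adjacent tope `T` of the minor?

Contraction (`adjacentTopes_contract`): compose `T` with a covector `Y` that is nonzero at all
nonloops. This fills in signs on the closure of `A` only, so erasing that closure gives `T` back.

Deletion of a coloop `i` (`adjacentTopes_delete_of_isColoop`): covectors are stable under erasing
`i`, so the sign at `i` is irrelevant.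

Deletion in general (`adjacentTopes_delete`): each `T \ F` lifts to a covector `X_F`, but the signs
of these lifts at `i` may disagree. If `i` is in the closure of `F`, the sign is forced to be zero.
The other `F` have a largest member `G` in the chain. A covector `W` that vanishes on `G`, agrees
with `T` on its support off `i`, and is nonzero at `i` fixes one sign for all of them: `W ∘ X_F` is
a lift of `T \ F` with the sign `W i` (`exists_consistent_sign`). -/

theorem mem_underlying_closure_iff (𝓜 : OrientedMatroid α) {A : Set α} {e : α} :
    e ∈ 𝓜.underlying.closure A ↔ e ∈ 𝓜.E ∧ 𝓜.InClosure A e := by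
  rw [← Matroid.closure_inter_ground, underlying_E,
    mem_underlying_closure 𝓜 Set.inter_subset_right]
  refine and_congr_right fun _ => forall₂_congr fun X hX => ?_
  refine imp_congr_left ⟨fun h f hf => ?_, fun h f hf => h f hf.1⟩
  by_contra h0
  exact h0 (h f ⟨hf, 𝓜.supp_subset X hX f h0⟩)

theorem contract_inClosure_iff (𝓜 : OrientedMatroid α) {A B : Set α} {e : α} :
    (𝓜.contract A).InClosure B e ↔ 𝓜.InClosure (B ∪ A) e :=
  ⟨fun h X hX h0 => h X ⟨hX, fun f hf => h0 f (Or.inr hf)⟩ fun f hf => h0 f (Or.inl hf),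
    fun h X hX h0 => h X hX.1 fun f hf => hf.elim (h0 f) (hX.2 f)⟩

theorem delete_inClosure_iff (𝓜 : OrientedMatroid α) {A B : Set α} {e : α} (he : e ∉ A) :
    (𝓜.delete A).InClosure B e ↔ 𝓜.InClosure (B \ A) e := by
  simp only [InClosure, delete, Set.forall_mem_image, signErase, he, if_false, Set.mem_sdiff]
  refine forall₂_congr fun X _ => imp_congr_left (forall_congr' fun f => ?_)
  by_cases hf : f ∈ A <;> simp [hf]

theorem underlying_contract (𝓜 : OrientedMatroid α) (A : Set α) :
    (𝓜.contract A).underlying = 𝓜.underlying.contract A := by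
  refine Matroid.ext_closure fun X => ?_
  ext e
  rw [Matroid.contract_closure_eq, Set.mem_sdiff, mem_underlying_closure_iff,
    mem_underlying_closure_iff, contract_inClosure_iff]
  exact and_right_comm

theorem underlying_delete (𝓜 : OrientedMatroid α) (A : Set α) :
    (𝓜.delete A).underlying = 𝓜.underlying.delete A := by
  refine Matroid.ext_closure fun X => ?_
  ext e
  rw [Matroid.delete_closure_eq, Set.mem_sdiff, mem_underlying_closure_iff,
    mem_underlying_closure_iff, and_right_comm]
  exact and_congr_right fun h => 𝓜.delete_inClosure_iff h.2

/-- The set `E \ L` of elements that are not loops. -/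
def nonloops (𝓜 : OrientedMatroid α) : Set α := {e | ∃ X ∈ 𝓜.covectors, X e ≠ 0}

theorem nonloops_subset (𝓜 : OrientedMatroid α) : 𝓜.nonloops ⊆ 𝓜.E :=
  fun e ⟨X, hX, h⟩ => 𝓜.supp_subset X hX e h

theorem mem_nonloops_of_ne_zero {𝓜 : OrientedMatroid α} {X : α → SignType}
    (hX : X ∈ 𝓜.covectors) {e : α} (he : X e ≠ 0) : e ∈ 𝓜.nonloops := ⟨X, hX, he⟩

theorem nonloops_eq (𝓜 : OrientedMatroid α) : 𝓜.nonloops = 𝓜.E \ 𝓜.underlying.loops := by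
  ext e
  rw [Matroid.loops, Set.mem_sdiff, mem_underlying_closure_iff]
  simp only [InClosure, nonloops, Set.mem_ofPred_eq, Set.mem_empty_iff_false, false_imp_iff,
    implies_true, true_imp_iff]
  have := 𝓜.nonloops_subset (a := e)
  simp only [nonloops, Set.mem_ofPred_eq] at this
  grind

theorem signErase_loops {𝓜 : OrientedMatroid α} {X : α → SignType} (hX : X ∈ 𝓜.covectors) :
    signErase X 𝓜.underlying.loops = X := by
  funext e
  by_cases he : e ∈ 𝓜.underlying.loops
  · have h : e ∉ 𝓜.nonloops := by simp [nonloops_eq, he]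
    have h0 : X e = 0 := by
      by_contra h0
      exact h ⟨X, hX, h0⟩
    simp [signErase, h0]
  · simp [signErase, he]

/-- Every covector is already zero at the loops. Hence passing to the loopfree oriented matroid
changes the ground set only, and all later arguments can use the covectors of `𝓜` itself. -/
theorem delete_loops_covectors (𝓜 : OrientedMatroid α) :
    (𝓜.delete 𝓜.underlying.loops).covectors = 𝓜.covectors := by
  ext X
  constructor
  · rintro ⟨Y, hY, rfl⟩
    simpa only [signErase_loops hY] using hY
  · exact fun hX => ⟨X, hX, signErase_loops hX⟩

theorem delete_loops_E (𝓜 : OrientedMatroid α) :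
    (𝓜.delete 𝓜.underlying.loops).E = 𝓜.nonloops := 𝓜.nonloops_eq.symm

theorem underlying_delete_loops (𝓜 : OrientedMatroid α) :
    (𝓜.delete 𝓜.underlying.loops).underlying = 𝓜.underlying.loopfree := by
  rw [underlying_delete, Matroid.loopfree,
    Matroid.contract_eq_delete_of_subset_loops subset_rfl]

theorem loopfree_E (𝓜 : OrientedMatroid α) : 𝓜.underlying.loopfree.E = 𝓜.nonloops :=
  𝓜.nonloops_eq.symm

theorem loopfree_isFlat_iff (𝓜 : OrientedMatroid α) {F : Set α} :
    𝓜.underlying.loopfree.IsFlat F ↔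
      ∃ X ∈ 𝓜.covectors, F = {e | e ∈ 𝓜.nonloops ∧ X e = 0} := by
  rw [← underlying_delete_loops, underlying_isFlat_iff, delete_loops_covectors, delete_loops_E]

theorem mem_loopfree_closure_iff (𝓜 : OrientedMatroid α) {A : Set α} {e : α} :
    e ∈ 𝓜.underlying.loopfree.closure A ↔ e ∈ 𝓜.nonloops ∧ 𝓜.InClosure A e := by
  rw [← underlying_delete_loops, mem_underlying_closure_iff, delete_loops_E, InClosure,
    delete_loops_covectors, InClosure]

/-- Over the nonloops, some covector vanishes exactly on the closure of `A`. -/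
theorem exists_covector_eq_zero_iff (𝓜 : OrientedMatroid α) (A : Set α) :
    ∃ X ∈ 𝓜.covectors, ∀ e ∈ 𝓜.nonloops, X e = 0 ↔ 𝓜.InClosure A e := by
  obtain ⟨X, hX, h⟩ := 𝓜.loopfree_isFlat_iff.1 (𝓜.underlying.loopfree.isFlat_closure A)
  refine ⟨X, hX, fun e he => ?_⟩
  have := Set.ext_iff.1 h e
  rw [mem_loopfree_closure_iff] at this
  simpa [he] using this.symm

theorem exists_covector_support_eq (𝓜 : OrientedMatroid α) :
    ∃ X ∈ 𝓜.covectors, ∀ e ∈ 𝓜.nonloops, X e ≠ 0 := by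
  obtain ⟨X, hX, h⟩ := 𝓜.exists_covector_eq_zero_iff ∅
  refine ⟨X, hX, fun e he h0 => ?_⟩
  obtain ⟨Y, hY, hYe⟩ := he
  exact hYe ((h e ⟨Y, hY, hYe⟩).1 h0 Y hY (by simp))

/-- Composing `T` with a covector that is nonzero at all nonloops gives a covector above `T`, so a
maximal `T` must have full support. -/
theorem isTope_iff (𝓜 : OrientedMatroid α) {T : α → SignType} :
    𝓜.IsTope T ↔ T ∈ 𝓜.covectors ∧ ∀ e ∈ 𝓜.nonloops, T e ≠ 0 := by
  constructor
  · rintro ⟨hT, hmax⟩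
    obtain ⟨X, hX, h⟩ := 𝓜.exists_covector_support_eq
    have := hmax _ (𝓜.comp_mem T hT X hX) fun e he => by simp [signComp, he]
    refine ⟨hT, fun e he h0 => h e he ?_⟩
    have h1 := congrFun this e
    simpa [signComp, h0] using h1
  · rintro ⟨hT, hne⟩
    refine ⟨hT, fun X hX hle => ?_⟩
    funext e
    by_cases he : T e = 0
    · by_contra hXe
      exact hne e ⟨X, hX, by rwa [he] at hXe⟩ he
    · exact (hle e he).symm

theorem adjacentTopes_eq_of_covectors_eq {𝓜 𝓝 : OrientedMatroid α}
    (h : 𝓜.covectors = 𝓝.covectors) (𝓕 : Set (Set α)) :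
    𝓜.adjacentTopes 𝓕 = 𝓝.adjacentTopes 𝓕 := by
  simp only [adjacentTopes, IsTope, h]

theorem mem_adjacentTopes_iff (𝓜 : OrientedMatroid α) {𝓕 : Set (Set α)} {T : α → SignType} :
    T ∈ 𝓜.adjacentTopes 𝓕 ↔ (T ∈ 𝓜.covectors ∧ ∀ e ∈ 𝓜.nonloops, T e ≠ 0) ∧
      ∀ F ∈ 𝓕, signErase T F ∈ 𝓜.covectors := by
  rw [adjacentTopes, Set.mem_ofPred_eq, isTope_iff]

/-- Removing the improper flats from a chain does not change the adjacent topes. -/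
theorem adjacentTopes_sdiff (𝓜 : OrientedMatroid α) (𝓕 : Set (Set α)) :
    𝓜.adjacentTopes (𝓕 \ {∅, 𝓜.nonloops}) = 𝓜.adjacentTopes 𝓕 := by
  ext T
  rw [mem_adjacentTopes_iff, mem_adjacentTopes_iff]
  refine and_congr_right fun hT => ⟨fun h F hF => ?_, fun h F hF => h F hF.1⟩
  by_cases hF' : F ∈ ({∅, 𝓜.nonloops} : Set (Set α))
  · rcases hF' with rfl | rfl
    · have : signErase T ∅ = T := by funext e; simp [signErase]
      rw [this]
      exact hT.1
    · have : signErase T 𝓜.nonloops = 0 := by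
        funext e
        by_cases he : T e = 0
        · simp [signErase, he]
        · simp [signErase, mem_nonloops_of_ne_zero hT.1 he]
      rw [this]
      exact 𝓜.zero_mem
  · exact h F ⟨hF, hF'⟩

end OrientedMatroid

/-! ### Chains of flats and their cones -/

/-- The vector of `∅` is zero and that of `E` is a generator anyway. Together with
`adjacentTopes_sdiff`, this makes it unnecessary to check that the chains in `pStar` and `pDiamond`
consist of proper nonempty flats; for a loop `i`, for instance, the closure of `i` without the loops
is empty. -/
theorem flagCone_sdiff {α : Type*} (E : Set α) (𝓕 : Set (Set α)) :
    flagCone E (𝓕 \ {∅, E}) = flagCone E 𝓕 := by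
  refine le_antisymm (Submodule.span_mono
    (Set.union_subset_union_left _ (Set.image_mono Set.sdiff_subset))) ?_
  refine Submodule.span_le.2 ?_
  rintro x (⟨F, hF, rfl⟩ | hx)
  · by_cases hF' : F ∈ ({∅, E} : Set (Set α))
    · rcases hF' with rfl | rfl
      · have : flatVector (∅ : Set α) = 0 := by funext e; simp [flatVector]
        rw [this]
        exact Submodule.zero_mem _
      · exact Submodule.subset_span (Or.inr (Or.inl rfl))
    · exact Submodule.subset_span (Or.inl ⟨F, ⟨hF, hF'⟩, rfl⟩)
  · exact Submodule.subset_span (Or.inr hx)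

namespace Matroid

theorem loopfree_loopfree {α : Type*} (M : Matroid α) : M.loopfree.loopfree = M.loopfree := by
  have h : M.loopfree.loops = ∅ := by
    rw [loopfree, contract_loops_eq, closure_loops, Set.sdiff_self]
  rw [loopfree, h, contract_empty]

theorem flagOf_loopfree {α : Type*} (M : Matroid α) (σ : PointedCone ℝ (α → ℝ)) :
    M.loopfree.flagOf σ = M.flagOf σ := by
  simp only [flagOf, loopfree_loopfree]

theorem flagOf_flagCone_of_isChain {α : Type*} (M : Matroid α) (hM : M.E.Finite)
    {𝓕 : Set (Set α)} (h𝓕 : ∀ F ∈ 𝓕, M.loopfree.IsFlat F) (hchain : IsChain (· ⊆ ·) 𝓕) :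
    M.flagOf (flagCone M.loopfree.E 𝓕) = 𝓕 \ {∅, M.loopfree.E} := by
  rw [← flagCone_sdiff]
  refine M.flagOf_flagCone hM ⟨fun F hF => ⟨h𝓕 F hF.1, ?_, ?_⟩, hchain.mono Set.sdiff_subset⟩
  · exact Set.nonempty_iff_ne_empty.2 fun h => hF.2 (Or.inl h)
  · exact fun h => hF.2 (Or.inr h)

theorem isFlag_flagOf {α : Type*} (M : Matroid α) (hM : M.E.Finite)
    {σ : PointedCone ℝ (α → ℝ)} (hσ : σ ∈ M.fan) : M.loopfree.IsFlag (M.flagOf σ) := by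
  obtain ⟨𝓕, h𝓕, rfl⟩ := hσ
  rwa [M.flagOf_flagCone hM h𝓕]

end Matroid

/-! ### Passing between elements of `ℤ₂^E` and sign vectors -/

theorem signErase_signPow {α : Type*} (S A : Set α) (ε : α → ZMod 2) :
    signErase (signPow S ε) A = signPow (S \ A) (coordProj A ε) := by
  funext e
  by_cases hA : e ∈ A <;> by_cases hS : e ∈ S <;> simp [signErase, signPow, coordProj, hA, hS]

theorem signPow_injOn {α : Type*} (S : Set α) :
    Set.InjOn (signPow S) {ε | ∀ e, e ∉ S → ε e = 0} := by
  intro ε hε δ hδ h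
  funext e
  by_cases he : e ∈ S
  · have h1 := congrFun h e
    simp only [signPow, he, if_true] at h1
    have h2 : ∀ a b : ZMod 2,
        (if a = 0 then (1 : SignType) else -1) = (if b = 0 then 1 else -1) → a = b := by decide
    exact h2 _ _ h1
  · rw [hε e he, hδ e he]

theorem exists_signPow_eq {α : Type*} {S : Set α} {T : α → SignType}
    (hT : ∀ e, T e ≠ 0 ↔ e ∈ S) : ∃ ε : α → ZMod 2, (∀ e, e ∉ S → ε e = 0) ∧ signPow S ε = T := by
  refine ⟨fun e => if T e = -1 then 1 else 0, fun e he => ?_, ?_⟩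
  · have : T e = 0 := by simpa [he] using hT e
    simp [this]
  · funext e
    have h := hT e
    by_cases he : e ∈ S
    · have h2 : ∀ t : SignType, t ≠ 0 →
        (if (if t = -1 then (1 : ZMod 2) else 0) = 0 then (1 : SignType) else -1) = t := by decide
      simp only [signPow, he, if_true]
      exact h2 _ (h.2 he)
    · have : T e = 0 := by simpa [he] using h
      simp [signPow, he, this]

namespace OrientedMatroid

variable {α : Type*}

theorem mem_phase_iff (𝓜 : OrientedMatroid α) {σ : PointedCone ℝ (α → ℝ)} {ε : α → ZMod 2} :
    ε ∈ 𝓜.phase σ ↔ (∀ e, e ∉ 𝓜.nonloops → ε e = 0) ∧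
      signPow 𝓜.nonloops ε ∈ 𝓜.adjacentTopes (𝓜.underlying.flagOf σ) := by
  rw [phase, phaseOfLoopfree, Set.mem_ofPred_eq, delete_loops_E,
    adjacentTopes_eq_of_covectors_eq 𝓜.delete_loops_covectors, underlying_delete_loops,
    Matroid.flagOf_loopfree]

/-- Equality of phases reduces to equality of sets of adjacent topes. -/
theorem phase_eq_coordProj_image {𝓜 𝓝 : OrientedMatroid α} {A : Set α} {𝓖 : Set (Set α)}
    {σ : PointedCone ℝ (α → ℝ)} (hS : 𝓝.nonloops = 𝓜.nonloops \ A)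
    (h𝓖 : ∀ F ∈ 𝓖, 𝓜.underlying.loopfree.IsFlat F) (hchain : IsChain (· ⊆ ·) 𝓖)
    (h : 𝓝.adjacentTopes (𝓝.underlying.flagOf σ) =
      (fun T => signErase T A) '' 𝓜.adjacentTopes 𝓖) :
    𝓝.phase σ = coordProj A '' 𝓜.phase (flagCone 𝓜.underlying.loopfree.E 𝓖) := by
  have hphase : ∀ ε, ε ∈ 𝓜.phase (flagCone 𝓜.underlying.loopfree.E 𝓖) ↔
      (∀ e, e ∉ 𝓜.nonloops → ε e = 0) ∧ signPow 𝓜.nonloops ε ∈ 𝓜.adjacentTopes 𝓖 := fun ε => by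
    rw [mem_phase_iff, Matroid.flagOf_flagCone_of_isChain _ 𝓜.finite_ground h𝓖 hchain,
      loopfree_E, adjacentTopes_sdiff]
  have hproj : ∀ ε : α → ZMod 2, (∀ e, e ∉ 𝓜.nonloops → ε e = 0) →
      ∀ e, e ∉ 𝓜.nonloops \ A → coordProj A ε e = 0 := fun ε hε e he => by
    by_cases heA : e ∈ A
    · simp [coordProj, heA]
    · simp [coordProj, hε e fun h' => he ⟨h', heA⟩]
  ext ε
  rw [mem_phase_iff, h, hS]
  constructor
  · rintro ⟨hε, T, hT, hTε⟩
    -- The support of a tope is exactly the set of nonloops, so a tope has the form `(-1)^δ`.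
    obtain ⟨δ, hδ, rfl⟩ := exists_signPow_eq (S := 𝓜.nonloops) (T := T) fun e =>
      ⟨mem_nonloops_of_ne_zero hT.1.1, (𝓜.mem_adjacentTopes_iff.1 hT).1.2 e⟩
    refine ⟨δ, (hphase δ).2 ⟨hδ, hT⟩, signPow_injOn _ (hproj δ hδ) hε ?_⟩
    rw [← signErase_signPow]
    exact hTε
  · rintro ⟨δ, hδ, rfl⟩
    rw [hphase] at hδ
    exact ⟨hproj δ hδ.1, _, hδ.2, signErase_signPow _ _ _⟩

end OrientedMatroid

/-! ### Setting coordinates to zero -/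

theorem signErase_congr {α : Type*} {X : α → SignType} {A B : Set α}
    (h : ∀ e, X e ≠ 0 → (e ∈ A ↔ e ∈ B)) : signErase X A = signErase X B := by
  funext e
  by_cases he : X e = 0
  · simp [signErase, he]
  · have := h e he
    by_cases hB : e ∈ B <;> simp_all [signErase]

theorem signErase_signErase {α : Type*} (X : α → SignType) (A B : Set α) :
    signErase (signErase X A) B = signErase X (A ∪ B) := by
  funext e
  by_cases hA : e ∈ A <;> by_cases hB : e ∈ B <;> simp [signErase, hA, hB]

theorem signErase_apply_of_notMem {α : Type*} {X : α → SignType} {A : Set α} {e : α}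
    (he : e ∉ A) : signErase X A e = X e := by
  simp [signErase, he]

theorem signErase_apply_of_mem {α : Type*} {X : α → SignType} {A : Set α} {e : α}
    (he : e ∈ A) : signErase X A e = 0 := by
  simp [signErase, he]

theorem signErase_singleton_self {α : Type*} (X : α → SignType) (i : α) :
    signErase X {i} i = 0 :=
  signErase_apply_of_mem rfl

theorem signErase_singleton_of_ne {α : Type*} (X : α → SignType) {i e : α} (he : e ≠ i) :
    signErase X {i} e = X e :=
  signErase_apply_of_notMem he

/-! ### Nonloops of minors, and adjacent topes of a contraction -/

namespace OrientedMatroid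

variable {α : Type*}

theorem contract_nonloops (𝓜 : OrientedMatroid α) (A : Set α) :
    (𝓜.contract A).nonloops = 𝓜.nonloops \ 𝓜.underlying.closure A := by
  ext e
  rw [Set.mem_sdiff, mem_underlying_closure_iff]
  constructor
  · rintro ⟨X, hX, he⟩
    exact ⟨⟨X, hX.1, he⟩, fun h => he (h.2 X hX.1 hX.2)⟩
  · rintro ⟨he, h⟩
    have : ¬ 𝓜.InClosure A e := fun h' => h ⟨𝓜.nonloops_subset he, h'⟩
    simp only [InClosure, not_forall] at this
    obtain ⟨X, hX, h0, hXe⟩ := this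
    exact ⟨X, ⟨hX, h0⟩, hXe⟩

theorem delete_nonloops (𝓜 : OrientedMatroid α) (A : Set α) :
    (𝓜.delete A).nonloops = 𝓜.nonloops \ A := by
  ext e
  simp only [nonloops, delete, Set.exists_mem_image, Set.mem_ofPred_eq, Set.mem_sdiff]
  by_cases he : e ∈ A <;> simp [signErase, he]

theorem closure_sdiff_loops (𝓜 : OrientedMatroid α) (A : Set α) :
    𝓜.underlying.closure A \ 𝓜.underlying.loops = 𝓜.underlying.loopfree.closure A := by
  ext e
  rw [mem_loopfree_closure_iff, nonloops_eq, Set.mem_sdiff, mem_underlying_closure_iff]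
  exact and_right_comm

theorem zero_of_mem_closure {𝓜 : OrientedMatroid α} {A : Set α} {X : α → SignType}
    (hX : X ∈ 𝓜.covectors) (h0 : ∀ f ∈ A, X f = 0) {e : α}
    (he : e ∈ 𝓜.underlying.closure A) : X e = 0 :=
  (𝓜.mem_underlying_closure_iff.1 he).2 X hX h0

/-- The two closures differ only in loops, where `X` is zero already. -/
theorem signErase_loopfree_closure {𝓜 : OrientedMatroid α} {A B : Set α} {X : α → SignType}
    (hX : X ∈ 𝓜.covectors) :
    signErase X (B ∪ 𝓜.underlying.loopfree.closure A) =
      signErase X (𝓜.underlying.closure A ∪ B) := by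
  refine signErase_congr fun e he => ?_
  have hS : e ∈ 𝓜.nonloops := ⟨X, hX, he⟩
  rw [Set.mem_union, Set.mem_union, mem_loopfree_closure_iff, mem_underlying_closure_iff]
  simp only [hS, 𝓜.nonloops_subset hS, true_and]
  exact or_comm

/-- Adding `cl(A)` turns flats of the contraction by `A` into flats. -/
theorem isFlat_union_closure (𝓜 : OrientedMatroid α) {A F : Set α}
    (hF : (𝓜.contract A).underlying.loopfree.IsFlat F) :
    𝓜.underlying.loopfree.IsFlat (F ∪ 𝓜.underlying.loopfree.closure A) := by
  obtain ⟨X, hX, rfl⟩ := (loopfree_isFlat_iff _).1 hF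
  refine 𝓜.loopfree_isFlat_iff.2 ⟨X, hX.1, ?_⟩
  ext e
  rw [contract_nonloops, Set.mem_union, mem_loopfree_closure_iff]
  simp only [Set.mem_ofPred_eq, Set.mem_sdiff, mem_underlying_closure_iff]
  constructor
  · rintro (h | h)
    · exact ⟨h.1.1, h.2⟩
    · exact ⟨h.1, h.2 X hX.1 hX.2⟩
  · rintro ⟨h, h0⟩
    by_cases hcl : 𝓜.InClosure A e
    · exact Or.inr ⟨h, hcl⟩
    · exact Or.inl ⟨⟨h, fun h' => hcl h'.2⟩, h0⟩

/-- The closure of `A` has to be in the chain: for a tope `T` of `𝓜`, erasing it yields a covector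
of the contraction exactly when the result is a covector of `𝓜`. The condition at `F` then becomes
the one at the union of `F` with this closure. -/
theorem adjacentTopes_contract (𝓜 : OrientedMatroid α) (A : Set α) (𝓕 : Set (Set α)) :
    (𝓜.contract A).adjacentTopes 𝓕 =
      (fun T => signErase T (𝓜.underlying.closure A)) ''
        𝓜.adjacentTopes (insert (𝓜.underlying.loopfree.closure A)
          ((fun F => F ∪ 𝓜.underlying.loopfree.closure A) '' 𝓕)) := by
  have hzero : ∀ T ∈ 𝓜.covectors, ∀ B, ∀ e ∈ A,
      signErase T (𝓜.underlying.closure A ∪ B) e = 0 := fun T hT B e he => by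
    by_cases heE : e ∈ 𝓜.E
    · exact signErase_apply_of_mem (Or.inl (𝓜.mem_underlying_closure_iff.2
        ⟨heE, fun X _ h => h e he⟩))
    · have : T e = 0 := by
        by_contra h
        exact heE (𝓜.supp_subset T hT e h)
      simp [signErase, this]
  ext T
  simp only [Set.mem_image, mem_adjacentTopes_iff, contract_nonloops, Set.forall_mem_insert]
  constructor
  · rintro ⟨⟨⟨hT, hTA⟩, hne⟩, h𝓕⟩
    obtain ⟨Y, hY, hYne⟩ := 𝓜.exists_covector_support_eq
    have hTY := 𝓜.comp_mem T hT Y hY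
    have herase : signErase (signComp T Y) (𝓜.underlying.closure A) = T := by
      funext e
      by_cases hcl : e ∈ 𝓜.underlying.closure A
      · rw [signErase_apply_of_mem hcl, zero_of_mem_closure hT hTA hcl]
      · rw [signErase_apply_of_notMem hcl, signComp]
        split_ifs with h0
        · rw [h0]
          by_contra hYe
          exact hne e ⟨⟨Y, hY, hYe⟩, hcl⟩ h0
        · rfl
    -- `T` vanishes on the closure of `A` and is nonzero at all other nonloops, so `Y` contributes
    -- signs on that closure only.
    refine ⟨signComp T Y, ⟨⟨hTY, fun e he => ?_⟩, ?_, ?_⟩, herase⟩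
    · by_cases h : T e = 0
      · simp [signComp, h, hYne e he]
      · simp [signComp, h]
    · have := signErase_loopfree_closure (A := A) (B := ∅) hTY
      rw [Set.empty_union, Set.union_empty] at this
      rwa [this, herase]
    · rintro _ ⟨F, hF, rfl⟩
      rw [signErase_loopfree_closure hTY, ← signErase_signErase, herase]
      exact (h𝓕 F hF).1
  · rintro ⟨T, ⟨⟨hT, hne⟩, hcl, h𝓕⟩, rfl⟩
    have h1 := signErase_loopfree_closure (A := A) (B := ∅) hT
    rw [Set.empty_union] at h1
    rw [h1] at hcl
    refine ⟨⟨⟨by simpa using hcl, ?_⟩, fun e he => ?_⟩, fun F hF => ⟨?_, ?_⟩⟩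
    · simpa using hzero T hT ∅
    · rw [signErase_apply_of_notMem he.2]
      exact hne e he.1
    · rw [signErase_signErase, ← signErase_loopfree_closure hT]
      exact h𝓕 _ ⟨F, hF, rfl⟩
    · rw [signErase_signErase]
      exact hzero T hT F

theorem phase_contract (𝓜 : OrientedMatroid α) (i : α) {σ : PointedCone ℝ (α → ℝ)}
    (hσ : σ ∈ (𝓜.underlying.contract {i}).fan) :
    (𝓜.contract {i}).phase σ = 𝓜.underlying.phaseContract 𝓜.phase i σ := by
  rw [← underlying_contract] at hσ
  have hflag := Matroid.isFlag_flagOf _ (𝓜.contract {i}).finite_ground hσ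
  rw [Matroid.phaseContract, Matroid.pDiamond, closure_sdiff_loops, ← underlying_contract]
  refine phase_eq_coordProj_image (𝓜.contract_nonloops _) ?_ ?_ (𝓜.adjacentTopes_contract _ _)
  · rintro F (rfl | ⟨G, hG, rfl⟩)
    · exact Matroid.isFlat_closure _
    · exact 𝓜.isFlat_union_closure (hflag.1 G hG).1
  · refine IsChain.insert ?_ ?_
    · rintro _ ⟨F, hF, rfl⟩ _ ⟨G, hG, rfl⟩ -
      exact (hflag.2.total hF hG).imp (fun h => Set.union_subset_union_left _ h)
        fun h => Set.union_subset_union_left _ h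
    · rintro _ ⟨F, hF, rfl⟩ -
      exact Or.inl Set.subset_union_right

/-! ### Adjacent topes of a deletion -/

/-- Over the nonloops of the deletion, the flats of `M \ i` agree with their closures in `M`. -/
theorem delete_inClosure_iff_mem (𝓜 : OrientedMatroid α) {A F : Set α}
    (hF : (𝓜.delete A).underlying.loopfree.IsFlat F) {e : α} (he : e ∈ 𝓜.nonloops)
    (heA : e ∉ A) : 𝓜.InClosure F e ↔ e ∈ F := by
  refine ⟨fun h => ?_, fun h X _ h0 => h0 e h⟩
  have hFA : F \ A = F := by
    have := hF.subset_ground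
    rw [loopfree_E, delete_nonloops] at this
    exact (Set.disjoint_left.2 fun a hF ha => (this hF).2 ha).sdiff_eq_left
  rw [← hF.closure, mem_loopfree_closure_iff, delete_nonloops, delete_inClosure_iff 𝓜 heA, hFA]
  exact ⟨⟨he, heA⟩, h⟩

/-- A coloop is not in the closure of its complement, so some covector `Y` has support `{i}`.
Eliminating `i` between `X` and whichever of `Y`, `-Y` has the opposite sign at `i` changes no other
coordinate. -/
theorem signErase_mem_of_isColoop {𝓜 : OrientedMatroid α} {i : α}
    (hi : 𝓜.underlying.IsColoop i) {X : α → SignType} (hX : X ∈ 𝓜.covectors) :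
    signErase X {i} ∈ 𝓜.covectors := by
  have hsep : ∃ Y ∈ 𝓜.covectors, (∀ f, f ≠ i → Y f = 0) ∧ Y i ≠ 0 := by
    have := (Matroid.isColoop_iff_forall_mem_closure_iff_mem.1 hi {i}ᶜ).not.2 (by simp)
    rw [mem_underlying_closure_iff] at this
    have hE : i ∈ 𝓜.E := hi.mem_ground
    simpa [InClosure, hE] using this
  have key : ∀ Y ∈ 𝓜.covectors, (∀ f, f ≠ i → Y f = 0) → X i ≠ 0 → X i = -Y i →
      signErase X {i} ∈ 𝓜.covectors := by
    intro Y hY hY0 hXi hXY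
    obtain ⟨Z, hZ, hZi, hZj⟩ := 𝓜.elim X hX Y hY i ⟨hXY, hXi⟩
    convert hZ
    funext e
    by_cases he : e = i
    · subst he
      rw [hZi, signErase_singleton_self]
    · rw [signErase_singleton_of_ne X he, hZj e]
      · by_cases h : X e = 0 <;> simp [signComp, h, hY0 e he]
      · rintro ⟨h1, h2⟩
        exact h2 (by simpa [hY0 e he] using h1)
  by_cases hXi : X i = 0
  · convert hX
    funext e
    by_cases he : e = i
    · subst he
      rw [hXi, signErase_singleton_self]
    · rw [signErase_singleton_of_ne X he]
  obtain ⟨Y, hY, hY0, hYi⟩ := hsep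
  have hcases : ∀ s t : SignType, s ≠ 0 → t ≠ 0 → s = -t ∨ s = -(-t) := by decide
  rcases hcases (X i) (Y i) hXi hYi with h | h
  · exact key Y hY hY0 hXi h
  · exact key (-Y) (𝓜.neg_mem Y hY) (fun f hf => by simp [hY0 f hf]) hXi h

theorem isFlat_insert_of_isColoop {𝓜 : OrientedMatroid α} {i : α}
    (hi : 𝓜.underlying.IsColoop i) {F : Set α}
    (hF : (𝓜.delete {i}).underlying.loopfree.IsFlat F) :
    𝓜.underlying.loopfree.IsFlat (insert i F) := by
  obtain ⟨_, ⟨X, hX, rfl⟩, rfl⟩ := (loopfree_isFlat_iff _).1 hF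
  refine 𝓜.loopfree_isFlat_iff.2 ⟨_, signErase_mem_of_isColoop hi hX, ?_⟩
  have hS : i ∈ 𝓜.nonloops := by
    rw [nonloops_eq]
    exact ⟨hi.mem_ground, hi.isNonloop.not_isLoop⟩
  ext e
  rw [delete_nonloops]
  by_cases he : e = i
  · subst he
    simp [hS, signErase]
  · simp [he]

theorem adjacentTopes_delete_of_isColoop {𝓜 : OrientedMatroid α} {i : α}
    (hi : 𝓜.underlying.IsColoop i) (𝓕 : Set (Set α)) :
    (𝓜.delete {i}).adjacentTopes 𝓕 =
      (fun T => signErase T {i}) ''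
        𝓜.adjacentTopes (insert {i} ((fun F => insert i F) '' 𝓕)) := by
  ext T
  simp only [Set.mem_image, mem_adjacentTopes_iff, delete_nonloops, Set.forall_mem_insert]
  constructor
  · rintro ⟨⟨⟨T, hT, rfl⟩, hne⟩, h𝓕⟩
    obtain ⟨Y, hY, hYne⟩ := 𝓜.exists_covector_support_eq
    have hTY := 𝓜.comp_mem T hT Y hY
    have herase : signErase (signComp T Y) {i} = signErase T {i} := by
      funext e
      by_cases hei : e ∈ ({i} : Set α)
      · rw [signErase_apply_of_mem hei, signErase_apply_of_mem hei]
      · rw [signErase_apply_of_notMem hei, signErase_apply_of_notMem hei, signComp]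
        split_ifs with h0
        · rw [h0]
          by_contra hYe
          refine hne e ⟨⟨Y, hY, hYe⟩, hei⟩ ?_
          exact (signErase_apply_of_notMem hei).trans h0
        · rfl
    refine ⟨signComp T Y, ⟨⟨hTY, fun e he => ?_⟩, signErase_mem_of_isColoop hi hTY, ?_⟩, herase⟩
    · by_cases h : T e = 0
      · simp [signComp, h, hYne e he]
      · simp [signComp, h]
    · rintro _ ⟨F, hF, rfl⟩
      -- Erasing `i` first leaves the vector `T \ F` of the deletion. Its lift `Z` stays a covector
      -- after erasing `i`.
      rw [Set.insert_eq, ← signErase_signErase, herase]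
      obtain ⟨Z, hZ, hZF⟩ := h𝓕 F hF
      rw [← hZF]
      exact signErase_mem_of_isColoop hi hZ
  · rintro ⟨T, ⟨⟨hT, hne⟩, -, h𝓕⟩, rfl⟩
    refine ⟨⟨⟨T, hT, rfl⟩, fun e he => ?_⟩, fun F hF => ⟨_, h𝓕 _ ⟨F, hF, rfl⟩, ?_⟩⟩
    · rw [signErase_apply_of_notMem he.2]
      exact hne e he.1
    · simp only [signErase_signErase]
      rw [Set.union_singleton, Set.insert_idem, Set.insert_eq]

/-- A covector that prescribes a consistent sign at `i` for all lifts of the vectors `T \ F`, where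
`F` runs through the members of a chain whose closure does not contain `i`. -/
theorem exists_consistent_sign (𝓜 : OrientedMatroid α) {i : α} {𝓕 : Set (Set α)}
    (hfin : 𝓕.Finite) (hchain : IsChain (· ⊆ ·) 𝓕) {T : α → SignType}
    (hne : ∀ e ∈ 𝓜.nonloops, e ≠ i → T e ≠ 0)
    (hlift : ∀ F ∈ 𝓕, ∃ X ∈ 𝓜.covectors, signErase X {i} = signErase T F) :
    ∃ W ∈ 𝓜.covectors, (∀ e, e ≠ i → W e ≠ 0 → W e = T e) ∧
      ∀ F ∈ 𝓕, ¬ 𝓜.InClosure F i → W i ≠ 0 ∧ ∀ e ∈ F, W e = 0 := by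
  by_cases hP : {F ∈ 𝓕 | ¬ 𝓜.InClosure F i}.Nonempty
  swap
  · refine ⟨0, 𝓜.zero_mem, by simp, fun F hF h => (hP ⟨F, hF, h⟩).elim⟩
  -- A covector vanishing on the largest such member vanishes on all the smaller ones, so `G` alone
  -- has to be dealt with.
  obtain ⟨G, ⟨hG, hGi⟩, hmax⟩ := (hfin.subset (Set.sep_subset 𝓕 _)).exists_maximal hP
  obtain ⟨X, hX, hXG⟩ := hlift G hG
  obtain ⟨Y, hY, hYG⟩ := 𝓜.exists_covector_eq_zero_iff G
  have hXe : ∀ e, e ≠ i → X e = signErase T G e := fun e he => by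
    rw [← hXG, signErase_singleton_of_ne X he]
  have hYe : ∀ e ∈ G, Y e = 0 := fun e he => by
    by_contra h
    exact h ((hYG e ⟨Y, hY, h⟩).2 fun X _ h0 => h0 e he)
  have hS : i ∈ 𝓜.nonloops := by
    by_contra h
    refine hGi fun X hX _ => ?_
    by_contra h0
    exact h ⟨X, hX, h0⟩
  -- `X` lifts `T \ G` but may vanish at `i`. Since `i` is not in the closure of `G`, the covector
  -- `Y` is nonzero at `i` while vanishing on `G`, so it repairs this without disturbing the zeros
  -- on `G`. Off `G` and `i`, the signs of `T` in `X` take precedence.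
  refine ⟨signComp X Y, 𝓜.comp_mem X hX Y hY, fun e he hW => ?_, fun F hF hFi => ⟨?_, ?_⟩⟩
  · by_cases heG : e ∈ G
    · refine (hW ?_).elim
      simp [signComp, hXe e he, signErase_apply_of_mem heG, hYe e heG]
    · have hXT : X e = T e := by rw [hXe e he, signErase_apply_of_notMem heG]
      have hT : T e ≠ 0 := hne e ⟨_, 𝓜.comp_mem X hX Y hY, hW⟩ he
      rw [signComp, hXT, if_neg hT]
  · by_cases h0 : X i = 0
    · simpa [signComp, h0] using (hYG i hS).not.2 hGi
    · simp [signComp, h0]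
  · intro e he
    have heG : e ∈ G := (hchain.total hF hG).elim (fun h => h he) fun h => hmax ⟨hF, hFi⟩ h he
    have hei : e ≠ i := fun h => hGi fun X _ h0 => h0 i (h ▸ heG)
    simp [signComp, hXe e hei, signErase_apply_of_mem heG, hYe e heG]

/-- The substance is the lifting direction. With `W` from `exists_consistent_sign` and any lift `X₀`
of `T`, the tope `W ∘ X₀` works for all `F` at once. Conversely, closing `F` in `𝓜` adds no nonloop
other than possibly `i`, so restricting a tope preserves the conditions. -/
theorem adjacentTopes_delete (𝓜 : OrientedMatroid α) {i : α} {𝓕 : Set (Set α)}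
    (h𝓕 : ∀ F ∈ 𝓕, (𝓜.delete {i}).underlying.loopfree.IsFlat F)
    (hchain : IsChain (· ⊆ ·) 𝓕) :
    (𝓜.delete {i}).adjacentTopes 𝓕 =
      (fun T => signErase T {i}) ''
        𝓜.adjacentTopes (𝓜.underlying.loopfree.closure '' 𝓕) := by
  ext T
  simp only [Set.mem_image, mem_adjacentTopes_iff, delete_nonloops]
  constructor
  · rintro ⟨⟨hT, hne⟩, hlift⟩
    have hTi : T i = 0 := by
      obtain ⟨X, -, rfl⟩ := hT
      exact signErase_singleton_self X i
    have hsub : ∀ F ∈ 𝓕, F ⊆ 𝓜.nonloops \ {i} := fun F hF => by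
      simpa only [loopfree_E, delete_nonloops] using (h𝓕 F hF).subset_ground
    have hfin : 𝓕.Finite :=
      𝓜.finite_ground.finite_subsets.subset fun F hF =>
        ((hsub F hF).trans Set.sdiff_subset).trans 𝓜.nonloops_subset
    obtain ⟨X₀, hX₀, hTX : signErase X₀ {i} = T⟩ := hT
    -- The chain is enlarged by `∅`, for which `T \ ∅ = T` lifts to `X₀`. This makes `W` nonzero at
    -- `i` whenever `i` is not a loop, as the lifted tope requires.
    obtain ⟨W, hW, hWT, hWi⟩ := 𝓜.exists_consistent_sign (i := i) (T := T) (hfin.insert ∅)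
      (hchain.insert fun F _ _ => Or.inl (Set.empty_subset F)) (fun e he hei => hne e ⟨he, hei⟩) (by
        rintro F (rfl | hF)
        · exact ⟨X₀, hX₀, by rw [hTX]; funext e; simp [signErase]⟩
        · exact hlift F hF)
    have hWX : ∀ e, e ≠ i → signComp W X₀ e = T e := fun e he => by
      rw [signComp]
      split_ifs with h0
      · rw [← hTX, signErase_singleton_of_ne X₀ he]
      · exact hWT e he h0
    have hcomp := 𝓜.comp_mem W hW X₀ hX₀
    refine ⟨signComp W X₀, ⟨⟨hcomp, fun e he => ?_⟩, ?_⟩, ?_⟩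
    · by_cases hei : e = i
      · subst hei
        have hcl : ¬ 𝓜.InClosure ∅ e := by
          obtain ⟨X, hX, hXe⟩ := he
          exact fun h => hXe (h X hX (by simp))
        simp [signComp, (hWi ∅ (Set.mem_insert _ _) hcl).1]
      · rw [hWX e hei]
        exact hne e ⟨he, hei⟩
    · rintro _ ⟨F, hF, rfl⟩
      obtain ⟨X, hX, hXF : signErase X {i} = signErase T F⟩ := hlift F hF
      have hXe : ∀ e, e ≠ i → X e = signErase T F e := fun e he => by
        rw [← hXF, signErase_singleton_of_ne X he]
      have hXzero : ∀ e ∈ F, X e = 0 := fun e he => by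
        rw [hXe e (hsub F hF he).2, signErase_apply_of_mem he]
      have hoff : ∀ e, e ≠ i →
          signErase (signComp W X₀) (𝓜.underlying.loopfree.closure F) e = X e := fun e he => by
        by_cases hS : e ∈ 𝓜.nonloops
        · have hmem : e ∈ 𝓜.underlying.loopfree.closure F ↔ e ∈ F := by
            rw [mem_loopfree_closure_iff, 𝓜.delete_inClosure_iff_mem (h𝓕 F hF) hS he]
            exact and_iff_right hS
          by_cases heF : e ∈ F
          · rw [signErase_apply_of_mem (hmem.2 heF), hXzero e heF]
          · rw [signErase_apply_of_notMem (hmem.not.2 heF), hXe e he,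
              signErase_apply_of_notMem heF, hWX e he]
        · have h0 : ∀ Z ∈ 𝓜.covectors, Z e = 0 := fun Z hZ => by
            by_contra h
            exact hS ⟨Z, hZ, h⟩
          simp [signErase, h0 _ hcomp, h0 _ hX]
      -- Away from `i`, the erased tope is the lift `X` of `T \ F`. If `i` is in the closure of `F`,
      -- both vanish at `i`. Otherwise the sign at `i` must be `W i`, and the covector sought is `W
      -- ∘ X`: as `W` vanishes on `F` and agrees with `T` on the rest of its support, the
      -- composition alters `X` at most at `i`.
      by_cases hFi : 𝓜.InClosure F i
      · convert hX
        funext e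
        by_cases hei : e = i
        · subst hei
          rw [hFi X hX hXzero]
          by_cases hS : e ∈ 𝓜.nonloops
          · exact signErase_apply_of_mem (𝓜.mem_loopfree_closure_iff.2 ⟨hS, hFi⟩)
          · have h0 : signComp W X₀ e = 0 := by
              by_contra h
              exact hS ⟨_, hcomp, h⟩
            simp [signErase, h0]
        · exact hoff e hei
      · obtain ⟨hWi0, hWF⟩ := hWi F (Set.mem_insert_of_mem _ hF) hFi
        convert 𝓜.comp_mem W hW X hX
        funext e
        by_cases hei : e = i
        · subst hei
          rw [signErase_apply_of_notMem fun h => hFi (𝓜.mem_loopfree_closure_iff.1 h).2]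
          simp [signComp, hWi0]
        · rw [hoff e hei, signComp]
          split_ifs with h0
          · rfl
          · have heF : e ∉ F := fun h => h0 (hWF e h)
            rw [hXe e hei, signErase_apply_of_notMem heF, hWT e hei h0]
    · funext e
      by_cases hei : e = i
      · subst hei
        rw [hTi, signErase_singleton_self]
      · rw [signErase_singleton_of_ne _ hei, hWX e hei]
  · rintro ⟨T, ⟨⟨hT, hne⟩, hcl⟩, rfl⟩
    refine ⟨⟨⟨T, hT, rfl⟩, fun e he => ?_⟩, fun F hF => ⟨_, hcl _ ⟨F, hF, rfl⟩, ?_⟩⟩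
    · rw [signErase_apply_of_notMem he.2]
      exact hne e he.1
    · simp only [signErase_signErase]
      refine signErase_congr fun e he => ?_
      have hS : e ∈ 𝓜.nonloops := ⟨T, hT, he⟩
      by_cases hei : e = i
      · simp [hei]
      · rw [Set.mem_union, Set.mem_union, mem_loopfree_closure_iff,
          𝓜.delete_inClosure_iff_mem (h𝓕 F hF) hS hei]
        simp [hei, hS]

theorem phase_delete (𝓜 : OrientedMatroid α) (i : α) {σ : PointedCone ℝ (α → ℝ)}
    (hσ : σ ∈ (𝓜.underlying.delete {i}).fan) :
    (𝓜.delete {i}).phase σ = 𝓜.underlying.phaseDelete 𝓜.phase i σ := by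
  rw [← underlying_delete] at hσ
  have hflag := Matroid.isFlag_flagOf _ (𝓜.delete {i}).finite_ground hσ
  rw [Matroid.phaseDelete, Matroid.pStar, ← underlying_delete]
  split_ifs with hi
  · refine phase_eq_coordProj_image (𝓜.delete_nonloops _) ?_ ?_
      (adjacentTopes_delete_of_isColoop hi _)
    · have hempty : (𝓜.delete {i}).underlying.loopfree.IsFlat ∅ := by
        obtain ⟨X, hX, hne⟩ := (𝓜.delete {i}).exists_covector_support_eq
        exact (loopfree_isFlat_iff _).2 ⟨X, hX, by ext e; simpa using hne e⟩
      rintro F (rfl | ⟨G, hG, rfl⟩)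
      · simpa using isFlat_insert_of_isColoop hi hempty
      · exact isFlat_insert_of_isColoop hi (hflag.1 G hG).1
    · refine IsChain.insert ?_ ?_
      · rintro _ ⟨F, hF, rfl⟩ _ ⟨G, hG, rfl⟩ -
        exact (hflag.2.total hF hG).imp (fun h => Set.insert_subset_insert h)
          fun h => Set.insert_subset_insert h
      · rintro _ ⟨F, hF, rfl⟩ -
        exact Or.inl (by simp)
  · refine phase_eq_coordProj_image (𝓜.delete_nonloops _) ?_ ?_
      (𝓜.adjacentTopes_delete (fun F hF => (hflag.1 F hF).1) hflag.2)
    · rintro _ ⟨F, -, rfl⟩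
      exact Matroid.isFlat_closure _
    · rintro _ ⟨F, hF, rfl⟩ _ ⟨G, hG, rfl⟩ -
      exact (hflag.2.total hF hG).imp (Matroid.closure_subset_closure _)
        (Matroid.closure_subset_closure _)

end OrientedMatroid

theorem proposition3p6 {α : Type*} (𝓜 : OrientedMatroid α) (i : α) (hi : i ∈ 𝓜.E) :
    ((𝓜.contract {i}).underlying = 𝓜.underlying.contract {i} ∧
      ∀ σ ∈ (𝓜.underlying.contract {i}).facets,
        (𝓜.contract {i}).phase σ = 𝓜.underlying.phaseContract 𝓜.phase i σ) ∧
    ((𝓜.delete {i}).underlying = 𝓜.underlying.delete {i} ∧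
      ∀ σ ∈ (𝓜.underlying.delete {i}).facets,
        (𝓜.delete {i}).phase σ = 𝓜.underlying.phaseDelete 𝓜.phase i σ) := by
  exact ⟨⟨𝓜.underlying_contract _, fun σ hσ => 𝓜.phase_contract i hσ.prop⟩,
    𝓜.underlying_delete _, fun σ hσ => 𝓜.phase_delete i hσ.prop⟩
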